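/- Identify $S^2$ with $\hat{\mathbb C}=\mathbb C\cup\{\infty\}$. A *topological cosine map* is an orientation-preserving ramified covering $f:S^2\setminus\{\infty\}\to S^2\setminus\{\infty\}$ with exactly two critical values $x_1\neq y_1$, such that $f(x_1)=f(y_1)$ and such that, for some base point $b\in S^2\setminus\{\infty,x_1,y_1\}$, some loops $\alpha,\beta$ generating $\pi_1(S^2\setminus\{\infty,x_1,y_1\},b)$ and some embedding of $\mathbb Z$ onto $f^{-1}(b)$, for every $n\in\mathbb Z$ the preimage $f^{-1}(\alpha)$ consists of paths connecting $2n$ to $2n+1$ twice (one lift of $\alpha$ in each direction) and $f^{-1}(\beta)$ consists of paths connecting $2n+1$ to $2n+2$ twice. Its postsingular set is $P_f=\{f^{\circ n}(x_1):n\ge 0\}\cup\{y_1,\infty\}$, and $f$ is *postsingularly finite* if $P_f$ is finite. For $\lambda\in\mathbb C^*$ let $C_\lambda(z)=\lambda\cos z$, with critical values $\lambda,-\lambda$ and $P_{C_\lambda}=\{C_\lambda^{\circ n}(\lambda):n\ge0\}\cup\{-\lambda,\infty\}$. The map $f$ is *combinatorially equivalent* to $g$ if there are orientation-preserving homeomorphisms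 $\varphi,\varphi'$ of $S^2$ fixing $\infty$ that agree on $P_f$, map $P_f$ onto $P_g$, are isotopic rel $P_f$, and satisfy $\varphi\circ f=g\circ\varphi'$ on $S^2\setminus\{\infty\}$. The Teichmüller space $\mathcal T_f$ is the set of classes $[\varphi]$ of orientation-preserving homeomorphisms $\varphi:S^2\to\hat{\mathbb C}$ with $\varphi(\infty)=\infty$ and $\varphi(x_1)=-\varphi(y_1)$, where $\varphi_1$ and $\varphi_2$ are equivalent if, for some $a\in\mathbb C^*$, $a\varphi_1$ and $\varphi_2$ agree on $P_f$ and are isotopic rel $P_f$. The Thurston pullback map $\sigma_f$ sends $[\varphi]$ to $[\varphi']$, where $\varphi'$ is a homeomorphism as above, again with $\varphi'(x_1)=-\varphi'(y_1)$, such that $\varphi\circ f=C_\lambda\circ\varphi'$ on $S^2\setminus\{\infty\}$ with $\lambda\in\{\varphi(x_1),\varphi(y_1)\}=\{\pm\varphi(x_1)\}$; it is regarded as defined at those points of $\mathcal T_f$ for which such a $\varphi'$ exists and $[\varphi']$ is uniquely determined. **Theorem.** Let $f$ be a postsingularly finite topological cosine map. Then $f$ is combinatorially equivalent to a postsingularly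 finite holomorphic cosine map $C_\lambda$ for some $\lambda\in\mathbb C^*$ if and only if $\sigma_f$ has a fixed point, that is, there is $\tau\in\mathcal T_f$ at which $\sigma_f$ is defined and $\sigma_f(\tau)=\tau$. -/

import Mathlib

open Filter Topology
open scoped unitInterval

noncomputable section

namespace CosineThurston

/-! ### Plane topology

The sphere `S²` is identified with `OnePoint ℂ = ℂ ∪ {∞}`, so that `S² ∖ {∞}` is `ℂ`.  The
homeomorphisms of the sphere that fix `∞` are exactly the extensions `φ.onePointCongr` of the
homeomorphisms `φ : ℂ ≃ₜ ℂ`. -/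

/-- `f` has local degree `n` at `z`: for all small `r > 0`, the loop
`t ↦ f (z + r e^{it}) - f z`, `0 ≤ t ≤ 2π`, avoids `0` and has winding number `n` about `0`
(computed with a continuous logarithm `g` of the loop). -/
def HasLocalDegree (f : ℂ → ℂ) (z : ℂ) (n : ℤ) : Prop :=
  ∀ᶠ r : ℝ in 𝓝[>] 0, ∃ g : ℝ → ℂ, Continuous g ∧
    (∀ t : ℝ, Complex.exp (g t) = f (z + r * Complex.exp (t * Complex.I)) - f z) ∧
    g (2 * Real.pi) - g 0 = 2 * Real.pi * n * Complex.I

/-- A (ramified covering) map of the plane is orientation-preserving if all its local degrees are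
positive. For a homeomorphism this is the usual notion, the local degrees being `1`. -/
def OrientationPreserving (f : ℂ → ℂ) : Prop :=
  ∀ z : ℂ, ∃ n : ℤ, 0 < n ∧ HasLocalDegree f z n

/-- Ramified (branched) covering maps of the plane: every point `w` has an open neighbourhood `V`
whose preimage is a disjoint union of open sets `U` on each of which `f : U → V` is, in suitable
topological disk coordinates, the map `z ↦ z ^ d` for some `d ≥ 1`, with `w` at the centre. -/
def IsRamifiedCovering (f : ℂ → ℂ) : Prop :=
  Continuous f ∧ ∀ w : ℂ, ∃ v : OpenPartialHomeomorph ℂ ℂ,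
    w ∈ v.source ∧ v w = 0 ∧ v.target = Metric.ball 0 1 ∧
    ∃ S : Set (Set ℂ), S.PairwiseDisjoint id ∧ ⋃₀ S = f ⁻¹' v.source ∧
      ∀ U ∈ S, ∃ (u : OpenPartialHomeomorph ℂ ℂ) (d : ℕ), 1 ≤ d ∧
        u.source = U ∧ u.target = Metric.ball 0 1 ∧ ∀ z ∈ U, v (f z) = u z ^ d

/-- The critical values of `f`: the images of the points near which `f` is not injective. -/
def criticalValues (f : ℂ → ℂ) : Set ℂ :=
  f '' {z | ¬ ∃ U ∈ 𝓝 z, Set.InjOn f U}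

/-- Two homeomorphisms of `X` are isotopic relative to `A`: they are joined by a homotopy through
homeomorphisms of `X` which is constant on `A`. In particular they agree on `A`. -/
def IsotopicRel {X : Type*} [TopologicalSpace X] (φ ψ : X ≃ₜ X) (A : Set X) : Prop :=
  ContinuousMap.HomotopicWith (φ : C(X, X)) (ψ : C(X, X))
    (fun h => IsHomeomorph h ∧ Set.EqOn h φ A)

/-! ### Topological cosine maps -/

/-- A self-map of `S² ∖ {∞} = ℂ` with two named points `x₁`, `y₁` (its critical values, in the
cases of interest). -/
structure MarkedMap where
  toFun : ℂ → ℂ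
  x₁ : ℂ
  y₁ : ℂ

namespace MarkedMap

/-- The plane punctured at the two marked points, that is `S² ∖ {∞, x₁, y₁}`. -/
abbrev Punctured (f : MarkedMap) : Type := {z : ℂ // z ≠ f.x₁ ∧ z ≠ f.y₁}

/-- `f` is a topological cosine map with critical values `x₁`, `y₁`: an orientation-preserving
ramified covering of the plane with exactly the two critical values `x₁ ≠ y₁`, which have the same
image, such that for some base point `b`, some loops `α`, `β` generating
`π₁(S² ∖ {∞, x₁, y₁}, b)` and some embedding `ι` of `ℤ` with image `f⁻¹(b)`, the preimage of `α`
consists of paths that connect `2n` to `2n+1` twice (one lift of `α` in each direction), and the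
preimage of `β` consists of paths that connect `2n+1` to `2n+2` twice. -/
def IsTopologicalCosine (f : MarkedMap) : Prop :=
  IsRamifiedCovering f.toFun ∧ OrientationPreserving f.toFun ∧
  f.x₁ ≠ f.y₁ ∧ criticalValues f.toFun = {f.x₁, f.y₁} ∧ f.toFun f.x₁ = f.toFun f.y₁ ∧
  ∃ (b : f.Punctured) (α β : Path b b) (ι : ℤ → ℂ),
    Subgroup.closure {FundamentalGroup.fromPath (Path.Homotopic.Quotient.mk α),
      FundamentalGroup.fromPath (Path.Homotopic.Quotient.mk β)} = ⊤ ∧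
    Function.Injective ι ∧ Set.range ι = f.toFun ⁻¹' {(b : ℂ)} ∧
    ∀ n : ℤ,
      (∃ γ : Path (ι (2 * n)) (ι (2 * n + 1)), ∀ t, f.toFun (γ t) = α t) ∧
      (∃ γ : Path (ι (2 * n + 1)) (ι (2 * n)), ∀ t, f.toFun (γ t) = α t) ∧
      (∃ γ : Path (ι (2 * n + 1)) (ι (2 * n + 2)), ∀ t, f.toFun (γ t) = β t) ∧
      (∃ γ : Path (ι (2 * n + 2)) (ι (2 * n + 1)), ∀ t, f.toFun (γ t) = β t)

/-- The postsingular set `P_f = {f^n(x₁) : n ≥ 0} ∪ {y₁, ∞}`, a subset of the sphere. -/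
def postsingularSet (f : MarkedMap) : Set (OnePoint ℂ) :=
  Set.range (fun n : ℕ => ((f.toFun^[n] f.x₁ : ℂ) : OnePoint ℂ)) ∪ {((f.y₁ : ℂ) : OnePoint ℂ), OnePoint.infty}

/-- `f` is postsingularly finite. -/
def PostsingularlyFinite (f : MarkedMap) : Prop := f.postsingularSet.Finite

/-- Combinatorial equivalence: orientation-preserving homeomorphisms `φ`, `φ'` of the sphere,
fixing `∞`, mapping `P_f` onto `P_g`, isotopic (and in particular equal on `P_f`) relative to
`P_f`, with `φ ∘ f = g ∘ φ'` on `S² ∖ {∞}`. -/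
def CombinatoriallyEquivalent (f g : MarkedMap) : Prop :=
  ∃ φ φ' : ℂ ≃ₜ ℂ, OrientationPreserving φ ∧ OrientationPreserving φ' ∧
    Set.EqOn φ.onePointCongr φ'.onePointCongr f.postsingularSet ∧
    φ.onePointCongr '' f.postsingularSet = g.postsingularSet ∧
    φ'.onePointCongr '' f.postsingularSet = g.postsingularSet ∧
    IsotopicRel φ.onePointCongr φ'.onePointCongr f.postsingularSet ∧
    ∀ z : ℂ, φ (f.toFun z) = g.toFun (φ' z)

end MarkedMap

/-- The holomorphic cosine map `C_c(z) = c cos z`, with critical values `c` and `-c`. -/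
def cosineMap (c : ℂ) : MarkedMap where
  toFun z := c * Complex.cos z
  x₁ := c
  y₁ := -c

/-! ### Teichmüller space -/

/-- Representatives of points of Teichmüller space: orientation-preserving homeomorphisms
`φ : (S², ∞) → (Ĉ, ∞)` normalized by `φ(x₁) = -φ(y₁)`. -/
structure Marking (f : MarkedMap) where
  toHomeo : ℂ ≃ₜ ℂ
  orientationPreserving : OrientationPreserving toHomeo
  normalized : toHomeo f.x₁ = -toHomeo f.y₁

/-- `φ` followed by the scaling `z ↦ a z` of `Ĉ`, as a homeomorphism of the sphere. -/
def scaled (a : ℂ) (ha : a ≠ 0) (φ : ℂ ≃ₜ ℂ) : OnePoint ℂ ≃ₜ OnePoint ℂ :=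
  (φ.trans (Homeomorph.mulLeft₀ a ha)).onePointCongr

/-- Two markings define the same point of Teichmüller space: up to a scaling of `Ĉ`, they agree on
`P_f` and are isotopic relative to `P_f`. -/
def Marking.Equiv {f : MarkedMap} (φ ψ : Marking f) : Prop :=
  ∃ (a : ℂ) (ha : a ≠ 0),
    IsotopicRel (scaled a ha φ.toHomeo) ψ.toHomeo.onePointCongr f.postsingularSet

theorem scaled_one (φ : ℂ ≃ₜ ℂ) : scaled 1 one_ne_zero φ = φ.onePointCongr := by
  ext z
  induction z using OnePoint.rec <;> simp [scaled]

theorem IsotopicRel.refl {X : Type*} [TopologicalSpace X] (φ : X ≃ₜ X) (A : Set X) :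
    IsotopicRel φ φ A :=
  ContinuousMap.HomotopicWith.refl _ ⟨φ.isHomeomorph, fun _ _ => rfl⟩

theorem IsotopicRel.eqOn {X : Type*} [TopologicalSpace X] {φ ψ : X ≃ₜ X} {A : Set X}
    (h : IsotopicRel φ ψ A) : Set.EqOn ψ φ A := by
  obtain ⟨F⟩ := h
  intro p hp
  have := (F.prop 1).2 hp
  simpa using this

theorem IsotopicRel.symm {X : Type*} [TopologicalSpace X] {φ ψ : X ≃ₜ X} {A : Set X}
    (h : IsotopicRel φ ψ A) : IsotopicRel ψ φ A := by
  have hA := h.eqOn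
  have h' := ContinuousMap.HomotopicWith.symm h
  obtain ⟨F⟩ := h'
  exact ⟨⟨F.toHomotopy, fun t => ⟨(F.prop t).1, fun p hp => ((F.prop t).2 hp).trans (hA hp).symm⟩⟩⟩

theorem IsotopicRel.trans {X : Type*} [TopologicalSpace X] {φ ψ χ : X ≃ₜ X} {A : Set X}
    (h : IsotopicRel φ ψ A) (h' : IsotopicRel ψ χ A) : IsotopicRel φ χ A := by
  have hA := h.eqOn
  obtain ⟨F⟩ := h'
  exact ContinuousMap.HomotopicWith.trans h
    ⟨⟨F.toHomotopy, fun t => ⟨(F.prop t).1, fun p hp => ((F.prop t).2 hp).trans (hA hp)⟩⟩⟩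

theorem IsotopicRel.postcomp {X : Type*} [TopologicalSpace X] {φ ψ : X ≃ₜ X} {A : Set X}
    (h : IsotopicRel φ ψ A) (χ : X ≃ₜ X) : IsotopicRel (φ.trans χ) (ψ.trans χ) A := by
  obtain ⟨F⟩ := h
  refine ⟨⟨⟨⟨fun p => χ (F p), χ.continuous.comp F.continuous⟩, ?_, ?_⟩, ?_⟩⟩
  · intro x; simp
  · intro x; simp
  · intro t
    refine ⟨χ.isHomeomorph.comp (F.prop t).1, fun p hp => ?_⟩
    exact congrArg χ ((F.prop t).2 hp)

theorem scaled_trans (a b : ℂ) (ha : a ≠ 0) (hb : b ≠ 0) (φ : ℂ ≃ₜ ℂ) :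
    (scaled a ha φ).trans (Homeomorph.mulLeft₀ b hb).onePointCongr =
      scaled (b * a) (mul_ne_zero hb ha) φ := by
  ext z
  induction z using OnePoint.rec <;> simp [scaled, mul_assoc]

theorem onePointCongr_trans_mul (b : ℂ) (hb : b ≠ 0) (φ : ℂ ≃ₜ ℂ) :
    φ.onePointCongr.trans (Homeomorph.mulLeft₀ b hb).onePointCongr = scaled b hb φ := by
  ext z
  induction z using OnePoint.rec <;> simp [scaled]

theorem Marking.equiv_equivalence (f : MarkedMap) :
    Equivalence (Marking.Equiv : Marking f → Marking f → Prop) where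
  refl φ := ⟨1, one_ne_zero, by rw [scaled_one]; exact IsotopicRel.refl _ _⟩
  symm := by
    rintro φ ψ ⟨a, ha, h⟩
    refine ⟨a⁻¹, inv_ne_zero ha, ?_⟩
    have := (h.postcomp (Homeomorph.mulLeft₀ a⁻¹ (inv_ne_zero ha)).onePointCongr).symm
    rw [scaled_trans, onePointCongr_trans_mul] at this
    simpa only [inv_mul_cancel₀ ha, scaled_one] using this
  trans := by
    rintro φ ψ χ ⟨a, ha, h⟩ ⟨b, hb, h'⟩
    refine ⟨b * a, mul_ne_zero hb ha, ?_⟩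
    have := h.postcomp (Homeomorph.mulLeft₀ b hb).onePointCongr
    rw [scaled_trans, onePointCongr_trans_mul] at this
    exact this.trans h'

/-- The equivalence of markings as a setoid. -/
instance markingSetoid (f : MarkedMap) : Setoid (Marking f) where
  r := Marking.Equiv
  iseqv := Marking.equiv_equivalence f

/-- The Teichmüller space `𝒯_f` modelled on `(S², P_f)`. -/
def TeichmullerSpace (f : MarkedMap) : Type := Quotient (markingSetoid f)

/-! ### The Thurston pullback map -/

/-- `τ' = [φ']` is a pullback of `τ = [φ]` under `f`: for some representatives, `φ ∘ f = C_c ∘ φ'`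
on `S² ∖ {∞}`, where `c` is the image under `φ` of a critical value, that is `c = ± φ(x₁)`. -/
def IsPullback (f : MarkedMap) (τ τ' : TeichmullerSpace f) : Prop :=
  ∃ φ φ' : Marking f, (⟦φ⟧ : Quotient (markingSetoid f)) = τ ∧
    (⟦φ'⟧ : Quotient (markingSetoid f)) = τ' ∧
    ∃ c : ℂ, (c = φ.toHomeo f.x₁ ∨ c = φ.toHomeo f.y₁) ∧
      ∀ z : ℂ, φ.toHomeo (f.toFun z) = c * Complex.cos (φ'.toHomeo z)

/-- The Thurston pullback map `σ_f : 𝒯_f → 𝒯_f`, as a map defined at those `τ` that have a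
pullback: `σ_f(τ)` is the unique pullback of `τ`. -/
def thurstonPullback (f : MarkedMap) : TeichmullerSpace f →. TeichmullerSpace f :=
  fun τ => ⟨∃! τ', IsPullback f τ τ', fun h => h.exists.choose⟩

end CosineThurston

end

namespace CosineThurston

/-! ### Lifting paths and homotopies through the cosine -/

/-! An equivalence `φ ∘ f = C_c ∘ φ'` with `φ`, `φ'` isotopic rel `P_f` says that `[φ]` is a
pullback of itself. It is a legitimate marking because the two critical values of `f` go to `±c`.
Conversely, if `[φ]` is its own pullback, then `φ'` is isotopic to some `a φ`, and `a φ ∘ f = C_{ac}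
∘ φ'`: the scale is absorbed into the parameter of the cosine, and the conjugacy on `P_f` carries it
onto the postsingular set of `C_{ac}`.

The remaining content is that pullbacks are unique, so that a self-pullback is a fixed point of the
partial map (`Marking.Equiv.of_pullback`). An isotopy between scaled markings fixes `±c`, hence
lifts through `c cos` (`PlaneIsotopy.exists_cos_lift`). The lift is constant on the image of `P_f`,
because `f` maps the finite part of `P_f` into itself and fibres of `cos` are countable. Its
endpoint differs from the second pullback by a homeomorphism `T` with `cos ∘ T = ± cos`. Such a `T`
is `z ↦ ± z + m` (`exists_eq_mul_add_of_cos_comp`); the normalization kills `m`, and the sign is a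
scaling. -/

theorem eq_of_continuous_of_countable {X Y : Type*} [TopologicalSpace X] [PreconnectedSpace X]
    [MetricSpace Y] {g : X → Y} (hg : Continuous g) {s : Set Y} (hs : s.Countable)
    (h : ∀ x, g x ∈ s) (x y : X) : g x = g y :=
  hs.isTotallyDisconnected (Set.range g) (Set.range_subset_iff.2 h) (isPreconnected_range hg)
    ⟨x, rfl⟩ ⟨y, rfl⟩

theorem countable_cos_fiber (w : ℂ) : {z : ℂ | Complex.cos z = w}.Countable := by
  by_cases hw : ∃ x, Complex.cos x = w
  · obtain ⟨x, rfl⟩ := hw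
    refine ((Set.countable_range fun k : ℤ => 2 * k * (Real.pi : ℂ) + x).union
      (Set.countable_range fun k : ℤ => 2 * k * (Real.pi : ℂ) - x)).mono fun z hz => ?_
    obtain ⟨k, h | h⟩ := Complex.cos_eq_cos_iff.1 (Eq.symm hz)
    · exact .inl ⟨k, h.symm⟩
    · exact .inr ⟨k, h.symm⟩
  · convert Set.countable_empty
    ext z
    simpa using fun h => hw ⟨z, h⟩

/-- Countable sets are totally disconnected. This replaces uniqueness of lifts and, unlike covering
theory, also applies at branch points. -/
theorem cos_lift_eq {X : Type*} [TopologicalSpace X] [PreconnectedSpace X] {g : X → ℂ}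
    (hg : Continuous g) {w : ℂ} (h : ∀ x, Complex.cos (g x) = w) (x y : X) : g x = g y :=
  eq_of_continuous_of_countable hg (countable_cos_fiber w) h x y

theorem exists_exp_lift {γ : I → ℂ} (hγ : Continuous γ) (h0 : ∀ t, γ t ≠ 0) :
    ∃ g : I → ℂ, Continuous g ∧ ∀ t, Complex.exp (g t) = γ t := by
  obtain ⟨Γ, hΓ, -⟩ := Complex.isCoveringMap_exp.exists_path_lifts
    ⟨fun t => (⟨γ t, h0 t⟩ : {z : ℂ // z ≠ 0}), by fun_prop⟩ (Complex.log (γ 0))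
    (Subtype.ext (by simp [Complex.exp_log (h0 0)]))
  exact ⟨Γ, Γ.continuous, fun t => congrArg Subtype.val (congrFun hΓ t)⟩

/-- Inverting `cos` means solving `γ = (v + v⁻¹) / 2`, so `v = γ + √(γ² - 1)`. Off `±1` the root and
then the logarithm of `v` can be chosen continuously by lifting through `exp`; a symmetry `w ↦ 2πk ±
w` corrects the initial point. -/
theorem exists_cos_lift {γ : I → ℂ} (hγ : Continuous γ) (h : ∀ t, γ t ^ 2 ≠ 1) {z : ℂ}
    (hz : Complex.cos z = γ 0) :
    ∃ g : I → ℂ, Continuous g ∧ g 0 = z ∧ ∀ t, Complex.cos (g t) = γ t := by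
  obtain ⟨s, hs, hs2⟩ := exists_exp_lift (γ := fun t => γ t ^ 2 - 1) (by fun_prop)
    (fun t => sub_ne_zero.2 (h t))
  set r : I → ℂ := fun t => Complex.exp (s t / 2) with hr
  have hr2 : ∀ t, r t * r t = γ t ^ 2 - 1 := fun t => by
    rw [hr, ← hs2 t, ← Complex.exp_add]; ring_nf
  have hmul : ∀ t, (γ t + r t) * (γ t - r t) = 1 := fun t => by linear_combination -hr2 t
  obtain ⟨u, hu, hu2⟩ := exists_exp_lift (γ := fun t => γ t + r t) (by fun_prop)
    (fun t => left_ne_zero_of_mul_eq_one (hmul t))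
  have hcos : ∀ t, Complex.cos (-Complex.I * u t) = γ t := fun t => by
    have e1 : -Complex.I * u t * Complex.I = u t := by
      linear_combination (-u t) * Complex.I_mul_I
    have e2 : -(-Complex.I * u t) * Complex.I = -u t := by
      linear_combination (u t) * Complex.I_mul_I
    have h3 : Complex.exp (-u t) = γ t - r t := by
      rw [Complex.exp_neg, hu2]
      exact inv_eq_of_mul_eq_one_right (hmul t)
    rw [Complex.cos, e1, e2, hu2, h3]
    ring
  obtain ⟨k, hk | hk⟩ := Complex.cos_eq_cos_iff.1 ((hcos 0).trans hz.symm)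
  · refine ⟨fun t => 2 * k * Real.pi + -Complex.I * u t, by fun_prop, hk.symm, fun t => ?_⟩
    rw [← hcos t]
    exact (Complex.cos_eq_cos_iff.2 ⟨k, .inl rfl⟩).symm
  · refine ⟨fun t => 2 * k * Real.pi - -Complex.I * u t, by fun_prop, hk.symm, fun t => ?_⟩
    rw [← hcos t]
    exact (Complex.cos_eq_cos_iff.2 ⟨k, .inr rfl⟩).symm

theorem sin_ne_zero_iff_cos_sq {z : ℂ} : Complex.sin z ≠ 0 ↔ Complex.cos z ^ 2 ≠ 1 := by
  have := Complex.sin_sq_add_cos_sq z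
  refine not_congr ⟨fun h => ?_, fun h => ?_⟩
  · simpa [h] using this
  · have h2 : Complex.sin z ^ 2 = 0 := by linear_combination this - h
    exact pow_eq_zero_iff two_ne_zero |>.1 h2

theorem exists_openPartialHomeomorph_eq_cos {z : ℂ} (hz : Complex.sin z ≠ 0) :
    ∃ e : OpenPartialHomeomorph ℂ ℂ, z ∈ e.source ∧ (e : ℂ → ℂ) = Complex.cos := by
  have h := (Complex.hasStrictDerivAt_cos z).hasStrictFDerivAt_equiv (neg_ne_zero.2 hz)
  exact ⟨h.toOpenPartialHomeomorph _, h.mem_toOpenPartialHomeomorph_source,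
    h.toOpenPartialHomeomorph_coe⟩

theorem isOpen_sin_ne_zero : IsOpen {z : ℂ | Complex.sin z ≠ 0} :=
  isOpen_ne_fun Complex.continuous_sin continuous_const

theorem isLocalHomeomorph_cos :
    IsLocalHomeomorph fun z : {z : ℂ // Complex.sin z ≠ 0} => Complex.cos z := by
  have h1 : IsLocalHomeomorphOn Complex.cos {z : ℂ | Complex.sin z ≠ 0} := fun z hz => by
    obtain ⟨e, he, h⟩ := exists_openPartialHomeomorph_eq_cos hz
    exact ⟨e, he, h.symm⟩
  have h2 : IsLocalHomeomorph (Subtype.val : {z : ℂ // Complex.sin z ≠ 0} → ℂ) :=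
    isOpen_sin_ne_zero.isOpenEmbedding_subtypeVal.isLocalHomeomorph
  rw [isLocalHomeomorph_iff_isLocalHomeomorphOn_univ] at h2 ⊢
  exact h1.comp h2 fun z _ => z.2

/-- A lift of a homotopy through the cosine is continuous at the branch points: the lifted paths
that start near a branch point cannot cross a small circle around it. -/
theorem continuousAt_cos_lift_of_branch {k l : I → ℂ → ℂ}
    (hk : Continuous fun p : I × ℂ => k p.1 p.2) (hl : ∀ z, Continuous fun t => l t z)
    (hl0 : ∀ z, l 0 z = z) (hcos : ∀ t z, Complex.cos (l t z) = k t (Complex.cos z)) {z₀ : ℂ}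
    (hz₀ : ∀ t, k t (Complex.cos z₀) = Complex.cos z₀) (t₀ : I) :
    ContinuousAt (fun p : I × ℂ => l p.1 p.2) (t₀, z₀) := by
  have hconst : ∀ t, l t z₀ = z₀ := fun t =>
    (cos_lift_eq (hl z₀) (w := Complex.cos z₀) (fun s => (hcos s z₀).trans (hz₀ s)) t 0).trans
      (hl0 z₀)
  rw [Metric.continuousAt_iff']
  intro ε hε
  -- The fibre has only countably many distances to `z₀`, so some circle of radius `r < ε` misses
  -- it; by compactness `cos` stays `m`-far from `cos z₀` on that circle.
  obtain ⟨r, hr, hr0, hrε⟩ := (((countable_cos_fiber (Complex.cos z₀)).image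
    fun w => ‖w - z₀‖).dense_compl ℝ).exists_between hε
  have hsph : ∀ w ∈ Metric.sphere z₀ r, 0 < ‖Complex.cos w - Complex.cos z₀‖ := fun w hw => by
    refine norm_pos_iff.2 (sub_ne_zero.2 fun h => hr ⟨w, h, ?_⟩)
    simpa [dist_eq_norm] using hw
  obtain ⟨m, hm0, hm⟩ := (isCompact_sphere z₀ r).exists_forall_le'
    (f := fun w => ‖Complex.cos w - Complex.cos z₀‖)
    (by fun_prop) hsph
  have hnear : ∀ᶠ z in 𝓝 z₀, ∀ t ∈ (Set.univ : Set I),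
      ‖k t (Complex.cos z) - Complex.cos z₀‖ < m := by
    refine isCompact_univ.eventually_forall_of_forall_eventually fun t _ => ?_
    have hc : Continuous fun q : ℂ × I => ‖k q.2 (Complex.cos q.1) - Complex.cos z₀‖ :=
      ((hk.comp (g := fun p : I × ℂ => k p.1 p.2) (continuous_snd.prodMk
        (Complex.continuous_cos.comp continuous_fst))).sub continuous_const).norm
    exact hc.continuousAt.eventually (Iio_mem_nhds (by simpa [hz₀] using hm0))
  have hball : ∀ᶠ z in 𝓝 z₀, ‖z - z₀‖ < r := by
    filter_upwards [Metric.ball_mem_nhds z₀ hr0] with z hz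
    simpa [dist_eq_norm] using hz
  have hkey : ∀ᶠ z in 𝓝 z₀, ∀ t, ‖l t z - z₀‖ < r := by
    filter_upwards [hnear, hball] with z h1 h2 t
    by_contra! h3
    -- A lifted path leaving the disk would meet the circle at some time `s`, where its image is too
    -- far from `cos z₀`.
    obtain ⟨s, hs⟩ := mem_range_of_exists_le_of_exists_ge (c := r)
      (((hl z).sub continuous_const).norm) ⟨0, by simpa [hl0] using h2.le⟩ ⟨t, h3⟩
    have h4 := hm (l s z) (by simpa [dist_eq_norm] using hs)
    rw [hcos] at h4
    exact (h1 s trivial).not_ge h4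
  filter_upwards [(continuous_snd.tendsto (t₀, z₀)).eventually hkey] with p hp
  rw [hconst, dist_eq_norm]
  exact (hp p.1).trans hrε

/-- Homotopy lifting for the branched covering `cos`, relative to the critical values `±1`. -/
theorem exists_cos_homotopy_lift {k : I → ℂ → ℂ} (hk : Continuous fun p : I × ℂ => k p.1 p.2)
    (hk0 : ∀ w, k 0 w = w) (hfix : ∀ t w, w ^ 2 = 1 → k t w = w)
    (hcrit : ∀ t w, k t w ^ 2 = 1 → w ^ 2 = 1) :
    ∃ l : I → ℂ → ℂ, (Continuous fun p : I × ℂ => l p.1 p.2) ∧ (∀ z, l 0 z = z) ∧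
      ∀ t z, Complex.cos (l t z) = k t (Complex.cos z) := by
  have hpath : ∀ z : ℂ, ∃ g : I → ℂ, Continuous g ∧ g 0 = z ∧
      ∀ t, Complex.cos (g t) = k t (Complex.cos z) := fun z => by
    by_cases hz : Complex.cos z ^ 2 = 1
    · exact ⟨fun _ => z, continuous_const, rfl, fun t => (hfix t _ hz).symm⟩
    · exact exists_cos_lift (hk.comp (.prodMk_left _)) (fun t h => hz (hcrit t _ h)) (hk0 _).symm
  choose g hg hg0 hcos using hpath
  refine ⟨fun t z => g z t, continuous_iff_continuousAt.2 ?_, hg0, fun t z => hcos z t⟩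
  rintro ⟨t₀, z₀⟩
  by_cases hz₀ : Complex.cos z₀ ^ 2 = 1
  · exact continuousAt_cos_lift_of_branch (l := fun t z => g z t) hk hg hg0
      (fun t z => hcos z t) (fun t => hfix t _ hz₀) t₀
  · have hsin : ∀ z t, Complex.sin z ≠ 0 → Complex.sin (g z t) ≠ 0 := fun z t hz => by
      rw [sin_ne_zero_iff_cos_sq] at hz ⊢
      rw [hcos]
      exact fun h => hz (hcrit t _ h)
    let E := {z : ℂ // Complex.sin z ≠ 0}
    -- Off the branch points `cos` is a local homeomorphism, so continuity at time `0` and along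
    -- each path gives joint continuity.
    have hcont : Continuous fun p : I × E => (⟨g p.2 p.1, hsin _ _ p.2.2⟩ : E) := by
      refine isLocalHomeomorph_cos.continuous_lift (T2Space.isSeparatedMap _)
        ⟨fun p : I × E => k p.1 (Complex.cos p.2), ?_⟩ ?_ ?_ ?_
      · exact hk.comp (g := fun p : I × ℂ => k p.1 p.2) (continuous_fst.prodMk
          (Complex.continuous_cos.comp (continuous_subtype_val.comp continuous_snd)))
      · ext p
        exact hcos _ _
      · simp only [hg0]
        exact continuous_id
      · exact fun z => (hg z).subtype_mk _
    have hemb : IsOpenEmbedding (Prod.map id Subtype.val : I × E → I × ℂ) :=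
      IsOpenEmbedding.id.prodMap isOpen_sin_ne_zero.isOpenEmbedding_subtypeVal
    exact (hemb.continuousAt_iff (x := (t₀, ⟨z₀, sin_ne_zero_iff_cos_sq.2 hz₀⟩))).1
      (continuous_subtype_val.comp hcont).continuousAt

/-! ### Isotopies of the plane -/

/-- An isotopy of the plane that starts at the identity: a continuous family of homeomorphisms
whose inverses also form a continuous family. -/
structure PlaneIsotopy where
  toFun : I → ℂ → ℂ
  invFun : I → ℂ → ℂ
  continuous_toFun : Continuous fun p : I × ℂ => toFun p.1 p.2
  continuous_invFun : Continuous fun p : I × ℂ => invFun p.1 p.2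
  left_inv : ∀ t z, invFun t (toFun t z) = z
  right_inv : ∀ t z, toFun t (invFun t z) = z
  zero : ∀ z, toFun 0 z = z

namespace PlaneIsotopy

/-- The homeomorphism of the plane at time `t`. -/
def homeo (k : PlaneIsotopy) (t : I) : ℂ ≃ₜ ℂ where
  toFun := k.toFun t
  invFun := k.invFun t
  left_inv := k.left_inv t
  right_inv := k.right_inv t
  continuous_toFun := k.continuous_toFun.comp (.prodMk_right t)
  continuous_invFun := k.continuous_invFun.comp (.prodMk_right t)

@[simp]
theorem homeo_apply (k : PlaneIsotopy) (t : I) (z : ℂ) : k.homeo t z = k.toFun t z := rfl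

/-- An isotopy of the plane extends continuously to the sphere. -/
theorem continuous_onePoint (k : PlaneIsotopy) :
    Continuous fun q : I × OnePoint ℂ => (k.homeo q.1).onePointCongr q.2 := by
  rw [continuous_iff_continuousAt]
  rintro ⟨t₀, p⟩
  induction p using OnePoint.rec with
  | infty =>
    have h0 : (k.homeo t₀).onePointCongr OnePoint.infty = OnePoint.infty := by simp
    rw [ContinuousAt, h0]
    refine OnePoint.hasBasis_nhds_infty.tendsto_right_iff.2 fun C hC => ?_
    -- Outside this compact set, swept out by the inverse images of `C`, no point enters `C` at any
    -- time.
    have hC' : IsCompact ((fun q : I × ℂ => k.invFun q.1 q.2) '' (Set.univ ×ˢ C)) :=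
      (isCompact_univ.prod hC.2).image k.continuous_invFun
    have hmem := OnePoint.hasBasis_nhds_infty.mem_of_mem ⟨hC'.isClosed, hC'⟩
    filter_upwards [(continuous_snd.tendsto (t₀, (OnePoint.infty : OnePoint ℂ))).eventually hmem]
    rintro ⟨t, p⟩ hp
    induction p using OnePoint.rec with
    | infty => simp
    | coe z =>
      refine .inl ⟨k.toFun t z, fun h => ?_, rfl⟩
      obtain ⟨z', hz', he⟩ := hp.resolve_right (OnePoint.coe_ne_infty z)
      rw [OnePoint.coe_injective he] at hz'
      exact hz' ⟨(t, k.toFun t z), ⟨trivial, h⟩, k.left_inv t z⟩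
  | coe z =>
    have hemb : IsOpenEmbedding (Prod.map id (↑) : I × ℂ → I × OnePoint ℂ) :=
      IsOpenEmbedding.id.prodMap OnePoint.isOpenEmbedding_coe
    refine (hemb.continuousAt_iff (x := (t₀, z))).1 ?_
    exact (OnePoint.continuous_coe.comp k.continuous_toFun).continuousAt

end PlaneIsotopy

/-- A continuous family of homeomorphisms of the sphere fixing `∞` and starting at the identity
restricts to an isotopy of the plane. -/
theorem exists_planeIsotopy {G : I × OnePoint ℂ → OnePoint ℂ} (hG : Continuous G)
    (hbij : ∀ t, Function.Bijective fun p => G (t, p)) (hinf : ∀ t, G (t, .infty) = .infty)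
    (h0 : ∀ p, G (0, p) = p) :
    ∃ k : PlaneIsotopy, ∀ t z, ((k.toFun t z : ℂ) : OnePoint ℂ) = G (t, z) := by
  have hΦ : Function.Bijective fun q : I × OnePoint ℂ => (q.1, G q) := by
    refine ⟨?_, ?_⟩
    · rintro ⟨t, p⟩ ⟨s, q⟩ h
      obtain ⟨rfl, h⟩ := Prod.mk.inj h
      rw [(hbij t).1 h]
    · rintro ⟨t, p⟩
      obtain ⟨q, hq⟩ := (hbij t).2 p
      exact ⟨(t, q), Prod.ext rfl hq⟩
  -- A continuous bijection from a compact space to a Hausdorff one: the inverses are therefore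
  -- jointly continuous in time and position.
  let Φ : I × OnePoint ℂ ≃ₜ I × OnePoint ℂ :=
    Continuous.homeoOfEquivCompactToT2 (f := Equiv.ofBijective _ hΦ) (continuous_fst.prodMk hG)
  have hΦa : ∀ q, Φ q = (q.1, G q) := fun _ => rfl
  have hfst : ∀ q, (Φ.symm q).1 = q.1 := fun q => by
    have := congrArg Prod.fst (Φ.apply_symm_apply q)
    rwa [hΦa] at this
  have hsnd : ∀ t p, G (t, (Φ.symm (t, p)).2) = p := fun t p => by
    have := congrArg Prod.snd (Φ.apply_symm_apply (t, p))
    rw [hΦa] at this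
    have e : Φ.symm (t, p) = (t, (Φ.symm (t, p)).2) := Prod.ext (hfst (t, p)) rfl
    rwa [e] at this
  have hex : ∀ t (z : ℂ), ∃ w : ℂ, (w : OnePoint ℂ) = G (t, z) := fun t z =>
    OnePoint.ne_infty_iff_exists.1 fun h =>
      OnePoint.coe_ne_infty z ((hbij t).1 (h.trans (hinf t).symm))
  have hex' : ∀ t (z : ℂ), ∃ w : ℂ, (w : OnePoint ℂ) = (Φ.symm (t, z)).2 := fun t z =>
    OnePoint.ne_infty_iff_exists.1 fun h => by
      have := hsnd t z
      rw [h, hinf] at this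
      exact OnePoint.infty_ne_coe z this
  choose k hk using hex
  choose k' hk' using hex'
  have hcont : ∀ {F : I × OnePoint ℂ → OnePoint ℂ} {m : I → ℂ → ℂ}, Continuous F →
      (∀ t z, ((m t z : ℂ) : OnePoint ℂ) = F (t, z)) → Continuous fun p : I × ℂ => m p.1 p.2 := by
    intro F m hF hm
    rw [OnePoint.isOpenEmbedding_coe.isInducing.continuous_iff]
    have : ((↑) : ℂ → OnePoint ℂ) ∘ (fun p : I × ℂ => m p.1 p.2) =
        F ∘ Prod.map id (↑) := funext fun p => hm _ _
    rw [this]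
    exact hF.comp (continuous_id.prodMap OnePoint.continuous_coe)
  refine ⟨⟨k, k', hcont hG hk, hcont (continuous_snd.comp Φ.symm.continuous) hk', ?_, ?_, ?_⟩, hk⟩
  · refine fun t z => OnePoint.coe_injective ?_
    rw [hk']
    refine (hbij t).1 ?_
    exact (hsnd _ _).trans (hk t z)
  · refine fun t z => OnePoint.coe_injective ?_
    rw [hk, hk', hsnd]
  · exact fun z => OnePoint.coe_injective ((hk 0 z).trans (h0 _))

/-- Isotopies of the sphere that fix `∞` are the isotopies of the plane. -/
theorem isotopicRel_onePointCongr_iff {φ ψ : ℂ ≃ₜ ℂ} {A : Set (OnePoint ℂ)}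
    (hA : OnePoint.infty ∈ A) :
    IsotopicRel φ.onePointCongr ψ.onePointCongr A ↔
      ∃ k : PlaneIsotopy, (∀ z, k.toFun 1 (φ z) = ψ z) ∧
        ∀ t (z : ℂ), (z : OnePoint ℂ) ∈ A → k.toFun t (φ z) = φ z := by
  constructor
  · rintro ⟨F⟩
    obtain ⟨k, hk⟩ := exists_planeIsotopy
      (G := fun q => F (q.1, φ.onePointCongr.symm q.2)) (by fun_prop)
      (fun t => (F.prop t).1.bijective.comp φ.onePointCongr.symm.bijective)
      (fun t => by
        have := (F.prop t).2 hA
        simpa using this)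
      (fun p => (F.apply_zero _).trans (φ.onePointCongr.apply_symm_apply p))
    have hk' : ∀ t z, ((k.toFun t (φ z) : ℂ) : OnePoint ℂ) = F (t, (z : OnePoint ℂ)) := fun t z => by
      rw [hk]
      simp
    refine ⟨k, fun z => OnePoint.coe_injective ?_, fun t z hz => OnePoint.coe_injective ?_⟩
    · rw [hk']
      simp
    · rw [hk']
      have := (F.prop t).2 hz
      simpa using this
  · rintro ⟨k, h1, hfix⟩
    refine ⟨⟨⟨⟨fun q => (k.homeo q.1).onePointCongr (φ.onePointCongr q.2), ?_⟩, ?_, ?_⟩, ?_⟩⟩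
    · exact k.continuous_onePoint.comp
        (continuous_fst.prodMk (φ.onePointCongr.continuous.comp continuous_snd))
    · intro p
      induction p using OnePoint.rec <;> simp [k.zero]
    · intro p
      induction p using OnePoint.rec <;> simp [h1]
    · intro t
      refine ⟨((φ.onePointCongr).trans (k.homeo t).onePointCongr).isHomeomorph, fun p hp => ?_⟩
      induction p using OnePoint.rec with
      | infty => simp
      | coe z => simp [hfix t z hp]

/-- An isotopy of the plane that fixes the critical values `±c` lifts through `z ↦ c cos z`. -/
theorem PlaneIsotopy.exists_cos_lift (k : PlaneIsotopy) {c : ℂ} (hc : c ≠ 0)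
    (h₁ : ∀ t, k.toFun t c = c) (h₂ : ∀ t, k.toFun t (-c) = -c) :
    ∃ l : PlaneIsotopy, ∀ t z, c * Complex.cos (l.toFun t z) = k.toFun t (c * Complex.cos z) := by
  have h₁' : ∀ t, k.invFun t c = c := fun t => by
    conv_lhs => rw [← h₁ t, k.left_inv]
  have h₂' : ∀ t, k.invFun t (-c) = -c := fun t => by
    conv_lhs => rw [← h₂ t, k.left_inv]
  -- Conjugation by `c` moves the critical values to `±1`. Both the isotopy and its inverse are
  -- lifted; the composites of the lifts stay in a fibre of `cos`, hence remain the identity.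
  have lift : ∀ {m m' : I → ℂ → ℂ}, (Continuous fun p : I × ℂ => m p.1 p.2) →
      (∀ z, m 0 z = z) → (∀ t, m t c = c) → (∀ t, m t (-c) = -c) →
      (∀ t z, m' t (m t z) = z) →
      ∃ l : I → ℂ → ℂ, (Continuous fun p : I × ℂ => l p.1 p.2) ∧ (∀ z, l 0 z = z) ∧
        ∀ t z, c * Complex.cos (l t z) = m t (c * Complex.cos z) := by
    intro m m' hm hm0 hm1 hm2 hm'
    have hsq : ∀ {w : ℂ}, w ^ 2 = 1 ↔ w = 1 ∨ w = -1 := fun {w} => by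
      simp
    obtain ⟨l, hl, hl0, hlc⟩ := exists_cos_homotopy_lift (k := fun t w => c⁻¹ * m t (c * w))
      (continuous_const.mul (hm.comp (g := fun p : I × ℂ => m p.1 p.2)
        (continuous_fst.prodMk (continuous_const.mul continuous_snd))))
      (fun w => by simp [hm0, hc])
      (fun t w hw => by
        obtain rfl | rfl := hsq.1 hw
        · simp [hm1, hc]
        · simp [hm2, hc])
      (fun t w hw => by
        have hmi : Function.Injective (m t) := Function.LeftInverse.injective (hm' t)
        refine hsq.2 ((hsq.1 hw).imp (fun h => ?_) fun h => ?_)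
        · have : m t (c * w) = m t c := by
            rw [hm1, (inv_mul_eq_iff_eq_mul₀ hc).1 h, mul_one]
          exact mul_left_cancel₀ hc ((hmi this).trans (mul_one c).symm)
        · have : m t (c * w) = m t (-c) := by
            rw [hm2, (inv_mul_eq_iff_eq_mul₀ hc).1 h, mul_neg_one]
          exact mul_left_cancel₀ hc ((hmi this).trans (mul_neg_one c).symm))
    exact ⟨l, hl, hl0, fun t z => by rw [hlc]; field_simp⟩
  have zero' : ∀ z, k.invFun 0 z = z := fun z => by
    conv_lhs => rw [← k.zero z, k.left_inv]
  obtain ⟨l, hl, hl0, hlc⟩ := lift k.continuous_toFun k.zero h₁ h₂ k.left_inv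
  obtain ⟨l', hl', hl0', hlc'⟩ := lift k.continuous_invFun zero' h₁' h₂' k.right_inv
  refine ⟨⟨l, l', hl, hl', fun t z => ?_, fun t z => ?_, hl0⟩, hlc⟩
  · have := cos_lift_eq (g := fun t => l' t (l t z)) (w := Complex.cos z)
      (hl'.comp (continuous_id.prodMk (hl.comp (.prodMk_left z))))
      (fun t => mul_left_cancel₀ hc (by rw [hlc', hlc, k.left_inv])) t 0
    simpa [hl0, hl0'] using this
  · have := cos_lift_eq (g := fun t => l t (l' t z)) (w := Complex.cos z)
      (hl.comp (continuous_id.prodMk (hl'.comp (.prodMk_left z))))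
      (fun t => mul_left_cancel₀ hc (by rw [hlc, hlc', k.right_inv])) t 0
    simpa [hl0, hl0'] using this

/-! ### Rigidity of the cosine -/

/-- A continuous self-map of the plane that preserves the cosine up to sign is `z ↦ ± z + m`. -/
theorem exists_eq_mul_add_of_cos_comp {T : ℂ → ℂ} (hT : Continuous T) {ε : ℂ} (hε : ε ^ 2 = 1)
    (h : ∀ z, Complex.cos (T z) = ε * Complex.cos z) :
    ∃ η m : ℂ, η ^ 2 = 1 ∧ ∀ z, T z = η * z + m := by
  have hcount : {z : ℂ | Complex.sin z = 0}.Countable :=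
    (Set.countable_range fun k : ℤ => (k : ℂ) * Real.pi).mono fun z hz => by
      obtain ⟨k, hk⟩ := Complex.sin_eq_zero_iff.1 hz
      exact ⟨k, hk.symm⟩
  have hsq : ∀ z, Complex.sin (T z) ^ 2 = Complex.sin z ^ 2 := fun z => by
    have h1 := Complex.sin_sq_add_cos_sq (T z)
    rw [h] at h1
    linear_combination h1 - Complex.sin_sq_add_cos_sq z - Complex.cos z ^ 2 * hε
  let U := {z : ℂ // z ∈ {z : ℂ | Complex.sin z = 0}ᶜ}
  have hU : IsPathConnected {z : ℂ | Complex.sin z = 0}ᶜ :=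
    hcount.isPathConnected_compl_of_one_lt_rank (by simp)
  have : PreconnectedSpace U := Subtype.preconnectedSpace hU.isConnected.isPreconnected
  obtain ⟨z₀, hz₀⟩ := hU.nonempty
  -- The quotient takes values `±1` on a connected set, the complement of countably many zeros, so
  -- its sign is a constant `δ`.
  let q : U → ℂ := fun z => Complex.sin (T z) / Complex.sin z
  have hq : Continuous q :=
    (Complex.continuous_sin.comp (hT.comp continuous_subtype_val)).div
      (Complex.continuous_sin.comp continuous_subtype_val) fun z => z.2
  have hq2 : ∀ z, q z ^ 2 = 1 := fun z => by
    have hz : Complex.sin z ≠ 0 := z.2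
    simp only [q]
    rw [div_pow, hsq, div_self (pow_ne_zero 2 hz)]
  have hqc : ∀ z, q z = q ⟨z₀, hz₀⟩ := fun z =>
    eq_of_continuous_of_countable hq (s := {1, -1}) (Set.toFinite _).countable
      (fun z => by simpa using sq_eq_sq_iff_eq_or_eq_neg.1 ((hq2 z).trans (one_pow 2).symm)) _ _
  set δ := q ⟨z₀, hz₀⟩ with hδ
  have hδ2 : δ ^ 2 = 1 := hq2 _
  have hsin : (fun z => Complex.sin (T z)) = fun z => δ * Complex.sin z := by
    refine Continuous.ext_on (hcount.dense_compl ℝ) (by fun_prop) (by fun_prop) fun z hz => ?_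
    exact (div_eq_iff (show Complex.sin z ≠ 0 from hz)).1 (hqc ⟨z, hz⟩)
  have hη : (ε * δ) ^ 2 = 1 := by rw [mul_pow, hε, hδ2, one_mul]
  have hexp : ∀ z, Complex.exp (T z * Complex.I) = ε * Complex.exp (ε * δ * z * Complex.I) :=
    fun z => by
      have hs : Complex.sin (T z) = δ * Complex.sin z := congrFun hsin z
      have hpm : ε * δ = 1 ∨ ε * δ = -1 := by
        simpa using sq_eq_sq_iff_eq_or_eq_neg.1 (hη.trans (one_pow 2).symm)
      rw [Complex.exp_mul_I, Complex.exp_mul_I, h, hs]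
      obtain h1 | h1 := hpm
      · rw [h1, one_mul]
        linear_combination Complex.sin z * Complex.I * (ε * h1 - δ * hε)
      · rw [h1, neg_one_mul, Complex.cos_neg, Complex.sin_neg]
        linear_combination Complex.sin z * Complex.I * (ε * h1 - δ * hε)
  have hε0 : ε ≠ 0 := by
    rintro rfl
    simp at hε
  have hper : ∀ z, Complex.exp ((T z - ε * δ * z) * Complex.I) = ε := fun z => by
    rw [sub_mul, Complex.exp_sub, hexp, mul_div_cancel_right₀ _ (Complex.exp_ne_zero _)]
  -- Constant cosine forces the continuous function `T z - ε δ z` to be constant.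
  have hcos : ∀ z, Complex.cos (T z - ε * δ * z) = (ε + ε⁻¹) / 2 := fun z => by
    rw [Complex.cos, neg_mul, Complex.exp_neg, hper]
  refine ⟨ε * δ, T 0, hη, fun z => ?_⟩
  have := cos_lift_eq (g := fun z => T z - ε * δ * z) (by fun_prop) hcos z 0
  simp only [mul_zero, sub_zero] at this
  linear_combination this

/-! ### Uniqueness of pullbacks -/

theorem MarkedMap.coe_mem_postsingularSet {f : MarkedMap} {z : ℂ} :
    (z : OnePoint ℂ) ∈ f.postsingularSet ↔ (∃ n : ℕ, f.toFun^[n] f.x₁ = z) ∨ z = f.y₁ := by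
  simp [MarkedMap.postsingularSet, or_comm]

theorem MarkedMap.infty_mem_postsingularSet (f : MarkedMap) :
    OnePoint.infty ∈ f.postsingularSet := by
  simp [MarkedMap.postsingularSet]

theorem MarkedMap.x₁_mem_postsingularSet (f : MarkedMap) :
    (f.x₁ : OnePoint ℂ) ∈ f.postsingularSet :=
  coe_mem_postsingularSet.2 (.inl ⟨0, rfl⟩)

theorem MarkedMap.y₁_mem_postsingularSet (f : MarkedMap) :
    (f.y₁ : OnePoint ℂ) ∈ f.postsingularSet :=
  coe_mem_postsingularSet.2 (.inr rfl)

theorem MarkedMap.map_mem_postsingularSet {f : MarkedMap} (hf : f.toFun f.x₁ = f.toFun f.y₁)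
    {z : ℂ} (hz : (z : OnePoint ℂ) ∈ f.postsingularSet) :
    (f.toFun z : OnePoint ℂ) ∈ f.postsingularSet := by
  rw [coe_mem_postsingularSet] at hz ⊢
  obtain ⟨n, rfl⟩ | rfl := hz
  · exact .inl ⟨n + 1, Function.iterate_succ_apply' _ _ _⟩
  · exact .inl ⟨1, hf⟩

theorem Marking.map_x₁_ne_zero {f : MarkedMap} (hxy : f.x₁ ≠ f.y₁) (φ : Marking f) :
    φ.toHomeo f.x₁ ≠ 0 := fun h => by
  have h2 := φ.normalized
  rw [h, eq_comm, neg_eq_zero, ← h] at h2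
  exact hxy (φ.toHomeo.injective h2).symm

/-- Equivalent markings have equivalent pullbacks: an isotopy between the markings lifts through
the cosine, and the remaining ambiguity is removed by the normalization. -/
theorem Marking.Equiv.of_pullback {f : MarkedMap} (hxy : f.x₁ ≠ f.y₁)
    (hf : f.toFun f.x₁ = f.toFun f.y₁) {φ₁ φ₂ ψ₁ ψ₂ : Marking f} (h : φ₁.Equiv φ₂) {c₁ c₂ : ℂ}
    (hc₁ : c₁ = φ₁.toHomeo f.x₁ ∨ c₁ = φ₁.toHomeo f.y₁)
    (hc₂ : c₂ = φ₂.toHomeo f.x₁ ∨ c₂ = φ₂.toHomeo f.y₁)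
    (h₁ : ∀ z, φ₁.toHomeo (f.toFun z) = c₁ * Complex.cos (ψ₁.toHomeo z))
    (h₂ : ∀ z, φ₂.toHomeo (f.toFun z) = c₂ * Complex.cos (ψ₂.toHomeo z)) :
    ψ₁.Equiv ψ₂ := by
  obtain ⟨a, ha, hiso⟩ := h
  obtain ⟨k, hk1, hkfix⟩ := (isotopicRel_onePointCongr_iff f.infty_mem_postsingularSet).1 hiso
  simp only [Homeomorph.trans_apply, Homeomorph.coe_mulLeft₀] at hk1 hkfix
  have hx0 := φ₁.map_x₁_ne_zero hxy
  have hny₁ : φ₁.toHomeo f.y₁ = -φ₁.toHomeo f.x₁ := by rw [φ₁.normalized, neg_neg]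
  have hny₂ : φ₂.toHomeo f.y₁ = -φ₂.toHomeo f.x₁ := by rw [φ₂.normalized, neg_neg]
  have hx₂ : φ₂.toHomeo f.x₁ = a * φ₁.toHomeo f.x₁ := by
    rw [← hk1, hkfix _ _ f.x₁_mem_postsingularSet]
  have hkx := fun t => hkfix t _ f.x₁_mem_postsingularSet
  have hky := fun t => hkfix t _ f.y₁_mem_postsingularSet
  rw [hny₁, mul_neg] at hky
  rw [hny₁] at hc₁
  rw [hny₂, hx₂] at hc₂
  have hc0 : a * c₁ ≠ 0 := by
    refine mul_ne_zero ha ?_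
    obtain rfl | rfl := hc₁
    · exact hx0
    · exact neg_ne_zero.2 hx0
  -- The sign `ε` records whether the two pullbacks use the same critical value as parameter.
  obtain ⟨ε, hε, hεc⟩ : ∃ ε : ℂ, ε ^ 2 = 1 ∧ a * c₁ = ε * c₂ := by
    obtain rfl | rfl := hc₁ <;> obtain rfl | rfl := hc₂
    · exact ⟨1, by simp, by ring⟩
    · exact ⟨-1, by simp, by ring⟩
    · exact ⟨-1, by simp, by ring⟩
    · exact ⟨1, by simp, by ring⟩
  have hfix : ∀ t, k.toFun t (a * c₁) = a * c₁ ∧ k.toFun t (-(a * c₁)) = -(a * c₁) := fun t => by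
    obtain rfl | rfl := hc₁
    · exact ⟨hkx t, hky t⟩
    · rw [mul_neg, neg_neg]
      exact ⟨hky t, hkx t⟩
  obtain ⟨l, hl⟩ := k.exists_cos_lift hc0 (fun t => (hfix t).1) fun t => (hfix t).2
  have hlP : ∀ t (z : ℂ), (z : OnePoint ℂ) ∈ f.postsingularSet →
      l.toFun t (ψ₁.toHomeo z) = ψ₁.toHomeo z := by
    intro t z hz
    have := cos_lift_eq (g := fun s => l.toFun s (ψ₁.toHomeo z))
      (w := Complex.cos (ψ₁.toHomeo z)) (l.continuous_toFun.comp (.prodMk_left _))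
      (fun s => mul_left_cancel₀ hc0 (by
        rw [hl, mul_assoc, ← h₁]
        exact hkfix s _ (MarkedMap.map_mem_postsingularSet hf hz))) t 0
    simpa only [l.zero] using this
  let χ : ℂ ≃ₜ ℂ := ψ₁.toHomeo.trans (l.homeo 1)
  have hχ : ∀ z, χ z = l.toFun 1 (ψ₁.toHomeo z) := fun _ => rfl
  have hχψ : IsotopicRel ψ₁.toHomeo.onePointCongr χ.onePointCongr f.postsingularSet :=
    (isotopicRel_onePointCongr_iff f.infty_mem_postsingularSet).2 ⟨l, fun _ => rfl, hlP⟩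
  have hc₂0 : c₂ ≠ 0 := by
    rintro rfl
    exact hc0 (hεc.trans (mul_zero _))
  obtain ⟨η, m, hη, hT⟩ := exists_eq_mul_add_of_cos_comp (T := fun z => ψ₂.toHomeo (χ.symm z))
    (by fun_prop) hε fun z => by
      obtain ⟨w, rfl⟩ := χ.surjective z
      refine mul_left_cancel₀ hc₂0 ?_
      rw [χ.symm_apply_apply, ← h₂, ← hk1, h₁, ← mul_assoc, ← hl, hεc, hχ]
      ring
  have hψχ : ∀ z, ψ₂.toHomeo z = η * χ z + m := fun z => by
    simpa using hT (χ z)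
  -- Both `χ` and `ψ₂` send `x₁`, `y₁` to opposite points, so the translation must fix the midpoint
  -- `0`.
  have hm : m = 0 := by
    have e := ψ₂.normalized
    rw [hψχ, hψχ, hχ, hχ, hlP _ _ f.x₁_mem_postsingularSet, hlP _ _ f.y₁_mem_postsingularSet,
      ψ₁.normalized] at e
    linear_combination e / 2
  have hη0 : η ≠ 0 := by
    rintro rfl
    simp at hη
  refine ⟨η, hη0, ?_⟩
  have hfin := hχψ.postcomp (Homeomorph.mulLeft₀ η hη0).onePointCongr
  rw [onePointCongr_trans_mul, onePointCongr_trans_mul] at hfin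
  have : scaled η hη0 χ = ψ₂.toHomeo.onePointCongr := by
    ext p
    induction p using OnePoint.rec <;> simp [scaled, hψχ, hm]
  rwa [this] at hfin

theorem IsPullback.unique {f : MarkedMap} (hxy : f.x₁ ≠ f.y₁)
    (hf : f.toFun f.x₁ = f.toFun f.y₁) {τ τ₁ τ₂ : TeichmullerSpace f} (h₁ : IsPullback f τ τ₁)
    (h₂ : IsPullback f τ τ₂) : τ₁ = τ₂ := by
  obtain ⟨φ₁, ψ₁, rfl, rfl, c₁, hc₁, e₁⟩ := h₁
  obtain ⟨φ₂, ψ₂, h, rfl, c₂, hc₂, e₂⟩ := h₂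
  exact Quotient.sound (Marking.Equiv.of_pullback hxy hf (Quotient.exact h.symm) hc₁ hc₂ e₁ e₂)

/-- Under a topological cosine map, the fixed points of the pullback map are the points that are
their own pullback. -/
theorem mem_thurstonPullback_self_iff {f : MarkedMap} (hxy : f.x₁ ≠ f.y₁)
    (hf : f.toFun f.x₁ = f.toFun f.y₁) {τ : TeichmullerSpace f} :
    τ ∈ thurstonPullback f τ ↔ IsPullback f τ τ := by
  constructor
  · rintro ⟨h, hτ⟩
    have := h.exists.choose_spec
    rwa [show h.exists.choose = τ from hτ] at this
  · intro h
    have hu : ∃! τ', IsPullback f τ τ' := ⟨τ, h, fun τ' h' => h'.unique hxy hf h⟩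
    exact ⟨hu, hu.unique hu.exists.choose_spec h⟩

/-! ### Combinatorial equivalence and fixed points -/

/-- Adding the constant `log a` to a continuous logarithm does not change its total increment. -/
theorem HasLocalDegree.const_mul {φ : ℂ → ℂ} {z : ℂ} {n : ℤ} (h : HasLocalDegree φ z n) {a : ℂ}
    (ha : a ≠ 0) : HasLocalDegree (fun w => a * φ w) z n := by
  filter_upwards [h] with r ⟨g, hg, he, hn⟩
  refine ⟨fun t => Complex.log a + g t, by fun_prop, fun t => ?_, ?_⟩
  · rw [Complex.exp_add, Complex.exp_log ha, he, mul_sub]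
  · rw [add_sub_add_left_eq_sub, hn]

theorem OrientationPreserving.const_mul {φ : ℂ → ℂ} (h : OrientationPreserving φ) {a : ℂ}
    (ha : a ≠ 0) : OrientationPreserving fun w => a * φ w := fun z => by
  obtain ⟨n, hn, hd⟩ := h z
  exact ⟨n, hn, hd.const_mul ha⟩

/-- Homeomorphisms intertwining two maps carry critical values to critical values. -/
theorem mem_criticalValues_of_semiconj {f g : ℂ → ℂ} {φ φ' : ℂ ≃ₜ ℂ}
    (h : ∀ z, φ (f z) = g (φ' z)) {w : ℂ} (hw : w ∈ criticalValues f) :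
    φ w ∈ criticalValues g := by
  obtain ⟨z, hz, rfl⟩ := hw
  refine ⟨φ' z, ?_, (h z).symm⟩
  rintro ⟨U, hU, hinj⟩
  refine hz ⟨φ' ⁻¹' U, φ'.continuous.continuousAt hU, fun a ha b hb hab => φ'.injective ?_⟩
  exact hinj ha hb (by rw [← h, ← h, hab])

/-- Where `sin ≠ 0` the inverse function theorem gives local injectivity. One inclusion suffices:
two distinct critical values of `f` sent into `{c, -c}` fill it. -/
theorem criticalValues_cosineMap_subset {c : ℂ} (hc : c ≠ 0) :
    criticalValues (cosineMap c).toFun ⊆ {c, -c} := by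
  rintro _ ⟨z, hz, rfl⟩
  have hsin : Complex.sin z = 0 := by
    by_contra hs
    obtain ⟨e, he, hcos⟩ := exists_openPartialHomeomorph_eq_cos hs
    refine hz ⟨e.source, e.open_source.mem_nhds he, fun a ha b hb hab => e.injOn ha hb ?_⟩
    rw [hcos]
    exact mul_left_cancel₀ hc hab
  have hcs : Complex.cos z ^ 2 = 1 := by
    simpa [hsin] using Complex.sin_sq_add_cos_sq z
  obtain h | h := sq_eq_sq_iff_eq_or_eq_neg.1 (hcs.trans (one_pow 2).symm)
  · exact .inl (by simp [cosineMap, h])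
  · exact .inr (by simp [cosineMap, h])

/-- A semiconjugacy to a cosine map that matches the critical values matches the postsingular
sets. -/
theorem image_postsingularSet_eq {f : MarkedMap} {c : ℂ}
    {φ φ' : ℂ ≃ₜ ℂ} (heq : ∀ z : ℂ, (z : OnePoint ℂ) ∈ f.postsingularSet → φ' z = φ z)
    (h : ∀ z, φ (f.toFun z) = (cosineMap c).toFun (φ' z))
    (hx : φ f.x₁ = c ∧ φ f.y₁ = -c ∨ φ f.x₁ = -c ∧ φ f.y₁ = c) :
    φ.onePointCongr '' f.postsingularSet = (cosineMap c).postsingularSet := by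
  have hstep : ∀ z : ℂ, (z : OnePoint ℂ) ∈ f.postsingularSet →
      φ (f.toFun z) = (cosineMap c).toFun (φ z) := fun z hz => by rw [h, heq z hz]
  -- The orbits are compared only from the first iterate on: `φ x₁` may be `-c`, but `cos` is even,
  -- so the orbits of `c` and `-c` then agree.
  have hiter : ∀ n, φ (f.toFun^[n + 1] f.x₁) = (cosineMap c).toFun^[n + 1] c := by
    have hmem : ∀ n, ((f.toFun^[n] f.x₁ : ℂ) : OnePoint ℂ) ∈ f.postsingularSet := fun n =>
      MarkedMap.coe_mem_postsingularSet.2 (.inl ⟨n, rfl⟩)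
    intro n
    induction n with
    | zero =>
      rw [Function.iterate_one, Function.iterate_one, hstep _ f.x₁_mem_postsingularSet]
      obtain ⟨h1, -⟩ | ⟨h1, -⟩ := hx <;> simp [cosineMap, h1]
    | succ n ih =>
      rw [Function.iterate_succ_apply', hstep _ (hmem _), ih]
      exact (Function.iterate_succ_apply' _ _ _).symm
  have hx₁ : (cosineMap c).x₁ = c := rfl
  have hy₁ : (cosineMap c).y₁ = -c := rfl
  have hc1 := (cosineMap c).x₁_mem_postsingularSet
  have hc2 := (cosineMap c).y₁_mem_postsingularSet
  have hf1 := f.x₁_mem_postsingularSet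
  have hf2 := f.y₁_mem_postsingularSet
  rw [hx₁] at hc1
  rw [hy₁] at hc2
  ext p
  induction p using OnePoint.rec with
  | infty =>
    exact ⟨fun _ => MarkedMap.infty_mem_postsingularSet _,
      fun _ => ⟨.infty, f.infty_mem_postsingularSet, by simp⟩⟩
  | coe w =>
    constructor
    · rintro ⟨p, hp, hpw⟩
      induction p using OnePoint.rec with
      | infty => simp at hpw
      | coe z =>
        have hzw : φ z = w := OnePoint.coe_injective (by simpa using hpw)
        subst hzw
        obtain ⟨n, rfl⟩ | rfl := MarkedMap.coe_mem_postsingularSet.1 hp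
        · cases n with
          | zero =>
            rw [Function.iterate_zero, id]
            obtain ⟨h1, -⟩ | ⟨h1, -⟩ := hx <;> rwa [h1]
          | succ n =>
            rw [hiter]
            exact MarkedMap.coe_mem_postsingularSet.2 (.inl ⟨n + 1, rfl⟩)
        · obtain ⟨-, h1⟩ | ⟨-, h1⟩ := hx <;> rwa [h1]
    · intro hw
      suffices ∃ z : ℂ, (z : OnePoint ℂ) ∈ f.postsingularSet ∧ φ z = w by
        obtain ⟨z, hz, rfl⟩ := this
        exact ⟨z, hz, by simp⟩
      obtain ⟨n, rfl⟩ | rfl := MarkedMap.coe_mem_postsingularSet.1 hw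
      · cases n with
        | zero =>
          obtain ⟨h1, -⟩ | ⟨-, h1⟩ := hx
          exacts [⟨_, hf1, h1⟩, ⟨_, hf2, h1⟩]
        | succ n => exact ⟨_, MarkedMap.coe_mem_postsingularSet.2 (.inl ⟨n + 1, rfl⟩), hiter n⟩
      · obtain ⟨-, h1⟩ | ⟨h1, -⟩ := hx
        exacts [⟨_, hf2, h1⟩, ⟨_, hf1, h1⟩]

/-- A combinatorial equivalence with a cosine map gives a point that is its own pullback. -/
theorem MarkedMap.CombinatoriallyEquivalent.exists_isPullback_self {f : MarkedMap}
    (hxy : f.x₁ ≠ f.y₁) (hcrit : criticalValues f.toFun = {f.x₁, f.y₁}) {c : ℂ} (hc : c ≠ 0)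
    (h : f.CombinatoriallyEquivalent (cosineMap c)) :
    ∃ τ : TeichmullerSpace f, IsPullback f τ τ := by
  obtain ⟨φ, φ', hφ, hφ', heq, -, -, hiso, hconj⟩ := h
  have hval : ∀ w ∈ criticalValues f.toFun, φ w = c ∨ φ w = -c := fun w hw =>
    criticalValues_cosineMap_subset hc (mem_criticalValues_of_semiconj hconj hw)
  have hx := hval f.x₁ (hcrit ▸ .inl rfl)
  have hy := hval f.y₁ (hcrit ▸ .inr rfl)
  have hne : φ f.x₁ ≠ φ f.y₁ := φ.injective.ne hxy
  have hnorm : φ f.x₁ = -φ f.y₁ := by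
    obtain hx | hx := hx <;> obtain hy | hy := hy <;> simp_all
  have heq' : ∀ z : ℂ, (z : OnePoint ℂ) ∈ f.postsingularSet → φ z = φ' z := fun z hz =>
    OnePoint.coe_injective (by simpa using heq hz)
  let m : Marking f := ⟨φ, hφ, hnorm⟩
  let m' : Marking f := ⟨φ', hφ', by
    rw [← heq' _ f.x₁_mem_postsingularSet, ← heq' _ f.y₁_mem_postsingularSet, hnorm]⟩
  have hmm : m.Equiv m' := ⟨1, one_ne_zero, by rwa [scaled_one]⟩
  refine ⟨⟦m⟧, m, m', rfl, (Quotient.sound hmm).symm, c, ?_, hconj⟩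
  rw [show m.toHomeo = φ from rfl]
  obtain hx | hx := hx
  · exact .inl hx.symm
  · exact .inr (by rw [← neg_eq_iff_eq_neg.2 hnorm, hx, neg_neg])

/-- A point that is its own pullback gives a combinatorial equivalence with a cosine map. -/
theorem IsPullback.exists_combinatoriallyEquivalent {f : MarkedMap} (hxy : f.x₁ ≠ f.y₁)
    (hpf : f.PostsingularlyFinite) {τ : TeichmullerSpace f}
    (h : IsPullback f τ τ) :
    ∃ c : ℂ, c ≠ 0 ∧ (cosineMap c).PostsingularlyFinite ∧
      f.CombinatoriallyEquivalent (cosineMap c) := by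
  obtain ⟨φ, φ', rfl, hφ', c, hc, hconj⟩ := h
  obtain ⟨a, ha, hiso⟩ : φ.Equiv φ' := Quotient.exact hφ'.symm
  -- Rescaling turns equality in Teichmüller space into an actual isotopy rel `P_f`, at the cost of
  -- replacing `c` by `a * c`.
  let ψ : ℂ ≃ₜ ℂ := φ.toHomeo.trans (Homeomorph.mulLeft₀ a ha)
  have hψ : ∀ z, ψ z = a * φ.toHomeo z := fun _ => rfl
  have hny : φ.toHomeo f.y₁ = -φ.toHomeo f.x₁ := by rw [φ.normalized, neg_neg]
  have hx0 := φ.map_x₁_ne_zero hxy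
  have hvals : ψ f.x₁ = a * c ∧ ψ f.y₁ = -(a * c) ∨ ψ f.x₁ = -(a * c) ∧ ψ f.y₁ = a * c := by
    rw [hψ, hψ, hny]
    rw [hny] at hc
    obtain rfl | rfl := hc
    · exact .inl ⟨rfl, mul_neg _ _⟩
    · exact .inr ⟨by ring, rfl⟩
  have hc0 : c ≠ 0 := by
    rw [hny] at hc
    obtain rfl | rfl := hc
    exacts [hx0, neg_ne_zero.2 hx0]
  have hEq : Set.EqOn φ'.toHomeo.onePointCongr ψ.onePointCongr f.postsingularSet := hiso.eqOn
  have heq : ∀ z : ℂ, (z : OnePoint ℂ) ∈ f.postsingularSet → φ'.toHomeo z = ψ z := fun z hz =>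
    OnePoint.coe_injective (by simpa using hEq hz)
  have hconj' : ∀ z, ψ (f.toFun z) = (cosineMap (a * c)).toFun (φ'.toHomeo z) := fun z => by
    rw [hψ, hconj]
    exact (mul_assoc _ _ _).symm
  have himg := image_postsingularSet_eq heq hconj' hvals
  refine ⟨a * c, mul_ne_zero ha hc0, ?_, ψ, φ'.toHomeo,
    φ.orientationPreserving.const_mul ha, φ'.orientationPreserving, hEq.symm, himg,
    hEq.image_eq.trans himg, hiso, hconj'⟩
  rw [MarkedMap.PostsingularlyFinite, ← himg]
  exact hpf.image _

end CosineThurston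

open CosineThurston in
theorem theorem2p1 (f : MarkedMap) (hf : f.IsTopologicalCosine)
    (hpf : f.PostsingularlyFinite) :
    (∃ c : ℂ, c ≠ 0 ∧ (cosineMap c).PostsingularlyFinite ∧
      f.CombinatoriallyEquivalent (cosineMap c)) ↔
    ∃ τ : TeichmullerSpace f, τ ∈ thurstonPullback f τ := by
  obtain ⟨-, -, hxy, hcrit, hfxy, -⟩ := hf
  simp only [mem_thurstonPullback_self_iff hxy hfxy]
  constructor
  · rintro ⟨c, hc, -, h⟩
    exact h.exists_isPullback_self hxy hcrit hc
  · rintro ⟨τ, h⟩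
    exact h.exists_combinatoriallyEquivalent hxy hpf
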